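/- Let $N,n\in\mathbb N$ with $2\le n\le N$ and let $Z=(z_{j,r})\in\mathbb C^{N\times n}$. For a finite set $A$ and $k\in\mathbb N$ write $A^k_{\ne}$ for the set of $k$-tuples of pairwise distinct elements of $A$, and $[m]=\{1,\dots,m\}$. Put $$\mathrm{Per}(Z)=\sum_{j\in[N]^n_{\ne}}\prod_{r=1}^n z_{j_r,r},\qquad \widetilde z_r=\frac1N\sum_{j=1}^N z_{j,r},\qquad y_{u,v,r}=z_{u,r}-z_{v,r},\qquad \beta=\frac1n\sum_{r=1}^n|\widetilde z_r|^2,$$ $$\widetilde p^{(2)}=\sum_{R\subseteq[n],\,|R|=2}\Big(\prod_{r\in[n]\setminus R}\widetilde z_r\Big)\sum_{j=1}^N\prod_{r\in R}(z_{j,r}-\widetilde z_r).$$ Let $$\vartheta_3=\frac{(N-3)!}{N!}\sqrt{\frac{(n-3)!}{n!}}\Big(\sum_{(r,s,t)\in[n]^3_{\ne}}\Big(\sum_{(u,v,w)\in[N]^3_{\ne}}|y_{u,v,r}\,y_{u,v,s}\,y_{u,w,t}|\Big)^2\Big)^{1/2}\quad\text{if } n\ge3,$$ $$\vartheta_4=\frac{(N-4)!}{N!}\sqrt{\frac{(n-4)!}{n!}}\Big(\sum_{(q,r,s,t)\in[n]^4_{\ne}}\Big(\sum_{(u,v,w,x)\in[N]^4_{\ne}}|y_{u,v,q}\,y_{u,v,r}\,y_{w,x,s}\,y_{w,x,t}|\Big)^2\Big)^{1/2}\quad\text{if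 } n\ge4,$$ with $\vartheta_3=0$ if $n=2$ and $\vartheta_4=0$ if $n\in\{2,3\}$. For $\nu\in\{3,4\}$ let $$\kappa^{(\nu)}=\frac{1}{(n-\nu)(N-\nu)}\max_{J\subseteq[N],\,R\subseteq[n],\,|J|=|R|=\nu}\ \sum_{j\in[N]\setminus J}\ \sum_{r\in[n]\setminus R}|z_{j,r}|^2\quad\text{if } n\ge\nu+1,\qquad \kappa^{(\nu)}=1\quad\text{if } n\le\nu,$$ and for $x_1,x_2\in\mathbb R$ let (with $0^0=1$, empty sums being $0$) $$f_n(x_1,x_2)=\sum_{k=3}^n(n+k-2)(n-k+1)\,x_1^{n-k}x_2^{k-3},\qquad g_n(x_1,x_2)=\sum_{k=4}^n(k-3)(n+k-2)(n-k+1)\,x_1^{n-k}x_2^{k-4}.$$ Then $$\Big|\frac{(N-n)!}{N!}\mathrm{Per}(Z)-\prod_{r=1}^n\widetilde z_r+\frac{\widetilde p^{(2)}}{N(N-1)}\Big|\le\frac{\vartheta_3}{2N^2}\,f_n\big(\sqrt\beta,\sqrt{\kappa^{(3)}}\big)+\frac{\vartheta_4}{8N^2}\,g_n\big(\sqrt\beta,\sqrt{\kappa^{(4)}}\big).$$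 -/

import Mathlib

namespace PermApprox

open Finset

/-- Permanent of a rectangular matrix with `N` rows and `n` columns: the sum over all injective maps
`j` from the columns to the rows of the products of the entries `Z (j r) r`. -/
noncomputable def rectPermanent {N n : ℕ} (Z : Matrix (Fin N) (Fin n) ℂ) : ℂ :=
  ∑ j : Fin n ↪ Fin N, ∏ r, Z (j r) r

/-- Arithmetic mean of the entries of column `r`. -/
noncomputable def colMean {N n : ℕ} (Z : Matrix (Fin N) (Fin n) ℂ) (r : Fin n) : ℂ :=
  (1 / (N : ℂ)) * ∑ j, Z j r

/-- The second order correction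
`∑_{|R| = 2} (∏_{r ∉ R} z̃ r) * ∑_j ∏_{r ∈ R} (z j r - z̃ r)`. -/
noncomputable def secondOrderTerm {N n : ℕ} (Z : Matrix (Fin N) (Fin n) ℂ) : ℂ :=
  ∑ R ∈ (univ : Finset (Fin n)).powersetCard 2,
    (∏ r ∈ Rᶜ, colMean Z r) * ∑ j, ∏ r ∈ R, (Z j r - colMean Z r)

/-- Difference of the entries in rows `u` and `v` of column `r`. -/
def rowDiff {N n : ℕ} (Z : Matrix (Fin N) (Fin n) ℂ) (u v : Fin N) (r : Fin n) : ℂ :=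
  Z u r - Z v r

/-- Mean of the squared moduli of the column means. -/
noncomputable def beta {N n : ℕ} (Z : Matrix (Fin N) (Fin n) ℂ) : ℝ :=
  (1 / (n : ℝ)) * ∑ r, ‖colMean Z r‖ ^ 2

/-- Embeddings `c : Fin 3 ↪ Fin n` and `u : Fin 3 ↪ Fin N` are the triples `(r, s, t)` of distinct
columns and `(u, v, w)` of distinct rows. -/
noncomputable def theta3 {N n : ℕ} (Z : Matrix (Fin N) (Fin n) ℂ) : ℝ :=
  if 3 ≤ n then
    ((N - 3).factorial / N.factorial : ℝ) * √((n - 3).factorial / n.factorial : ℝ) *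
      √(∑ c : Fin 3 ↪ Fin n,
        (∑ u : Fin 3 ↪ Fin N,
          ‖rowDiff Z (u 0) (u 1) (c 0) * rowDiff Z (u 0) (u 1) (c 1) *
            rowDiff Z (u 0) (u 2) (c 2)‖) ^ 2)
  else 0

/-- Embeddings `c : Fin 4 ↪ Fin n` and `u : Fin 4 ↪ Fin N` are the quadruples `(q, r, s, t)` of
distinct columns and `(u, v, w, x)` of distinct rows. -/
noncomputable def theta4 {N n : ℕ} (Z : Matrix (Fin N) (Fin n) ℂ) : ℝ :=
  if 4 ≤ n then
    ((N - 4).factorial / N.factorial : ℝ) * √((n - 4).factorial / n.factorial : ℝ) *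
      √(∑ c : Fin 4 ↪ Fin n,
        (∑ u : Fin 4 ↪ Fin N,
          ‖rowDiff Z (u 0) (u 1) (c 0) * rowDiff Z (u 0) (u 1) (c 1) *
            rowDiff Z (u 2) (u 3) (c 2) * rowDiff Z (u 2) (u 3) (c 3)‖) ^ 2)
  else 0

/-- The supremum is over the finite set of pairs `(J, R)` of a set of `ν` rows and a set of `ν`
columns, which is nonempty if `ν ≤ n ≤ N`; then it is a maximum. -/
noncomputable def kappa {N n : ℕ} (Z : Matrix (Fin N) (Fin n) ℂ) (ν : ℕ) : ℝ :=
  if ν + 1 ≤ n then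
    (1 / (((n : ℝ) - ν) * ((N : ℝ) - ν))) *
      ⨆ q : { q : Finset (Fin N) × Finset (Fin n) // q.1.card = ν ∧ q.2.card = ν },
        ∑ j ∈ q.1.1ᶜ, ∑ r ∈ q.1.2ᶜ, ‖Z j r‖ ^ 2
  else 1

/-- `f_n(x, y) = ∑_{k=3}^n (n+k-2)(n-k+1) x^{n-k} y^{k-3}`. -/
def fPoly (n : ℕ) (x y : ℝ) : ℝ :=
  ∑ k ∈ Icc 3 n, ((n : ℝ) + k - 2) * ((n : ℝ) - k + 1) * x ^ (n - k) * y ^ (k - 3)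

/-- `g_n(x, y) = ∑_{k=4}^n (k-3)(n+k-2)(n-k+1) x^{n-k} y^{k-4}`. -/
def gPoly (n : ℕ) (x y : ℝ) : ℝ :=
  ∑ k ∈ Icc 4 n,
    ((k : ℝ) - 3) * ((n : ℝ) + k - 2) * ((n : ℝ) - k + 1) * x ^ (n - k) * y ^ (k - 4)

end PermApprox

/-!
Read `Per` as an average: the normalized permanent is the mean of a product of entries in which
distinct rows are assigned to the columns by uniformly random permutations of rows and columns.
Replace the random entries by column means one index at a time. In the change caused by one
replacement, a random entry minus its column mean appears; exchanging two random rows is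
antisymmetric, so this change is `1 / N` times a sum of means containing two differences of entries
in two common rows. Replacing the remaining entries in these means produces the second order term,
and a remainder with three or four differences and a further factor `1 / N`.

In the remainder, the products of entries at distinct random rows outside finitely many rows are
bounded by the Carlen-Lieb-Loss inequality, a Hadamard type inequality for permanents, which
follows from Banach's theorem that a symmetric multilinear form attains its norm on the diagonal.
Maclaurin's inequality for elementary symmetric means then averages over the random columns.
-/

namespace PermApprox

open Finset Equiv
open scoped BigOperators

section GroupAverages

theorem expect_smul {G X M : Type*} [Group G] [Fintype G] [Fintype X] [MulAction G X]
    [MulAction.IsPretransitive G X] [AddCommMonoid M] [Module ℚ≥0 M] (f : X → M) (x : X) :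
    𝔼 g : G, f (g • x) = 𝔼 y, f y := by
  have hconst (y : X) : 𝔼 g : G, f (g • x) = 𝔼 g : G, f (g • y) := by
    obtain ⟨h, rfl⟩ := MulAction.exists_smul_eq G x y
    exact Fintype.expect_equiv (Equiv.mulRight h⁻¹) _ _ fun g => by simp [mul_smul]
  have : Nonempty X := ⟨x⟩
  calc 𝔼 g : G, f (g • x) = 𝔼 y : X, 𝔼 g : G, f (g • y) := by
        rw [← expect_congr rfl fun y _ => hconst y, Fintype.expect_const]
    _ = 𝔼 g : G, 𝔼 y : X, f (g • y) := expect_comm ..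
    _ = 𝔼 _g : G, 𝔼 y : X, f y :=
        expect_congr rfl fun g _ => Fintype.expect_equiv (MulAction.toPerm g) _ _ fun _ => rfl
    _ = 𝔼 y, f y := Fintype.expect_const _

variable {α κ M : Type*} [Fintype α] [DecidableEq α] [AddCommMonoid M] [Module ℚ≥0 M]

theorem expect_perm_mul_right (f : Perm α → M) (ρ : Perm α) : 𝔼 σ, f (σ * ρ) = 𝔼 σ, f σ :=
  Fintype.expect_equiv (Equiv.mulRight ρ) _ _ fun _ => rfl

theorem expect_perm_apply (f : α → M) (a : α) : 𝔼 σ : Perm α, f (σ a) = 𝔼 j, f j :=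
  expect_smul (G := Perm α) f a

theorem expect_perm_embedding [Fintype κ] (f : (κ ↪ α) → M) (e : κ ↪ α) :
    𝔼 σ : Perm α, f (e.trans σ.toEmbedding) = 𝔼 u, f u := by
  have : MulAction.IsPretransitive (Perm α) (κ ↪ α) := ⟨fun u v => by
    obtain ⟨σ, hσ⟩ := Perm.exists_extending_pair u v u.injective v.injective
    exact ⟨σ, by ext i; exact hσ i⟩⟩
  exact expect_smul (G := Perm α) f e

theorem expect_perm_map (f : Finset α → M) (A : Finset α) :
    𝔼 τ : Perm α, f (A.map τ.toEmbedding) = 𝔼 R ∈ univ.powersetCard #A, f R := by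
  have := Set.powersetCard.isPretransitive (α := α) (n := #A)
  calc 𝔼 τ : Perm α, f (A.map τ.toEmbedding)
      = 𝔼 τ : Perm α, f ((τ • ⟨A, rfl⟩ : Set.powersetCard α #A) : Finset α) :=
        expect_congr rfl fun τ _ => by rw [map_eq_image]; rfl
    _ = 𝔼 R : Set.powersetCard α #A, f R := expect_smul (fun R : Set.powersetCard α #A => f R) _
    _ = _ := expect_nbij Subtype.val (by simp) (fun _ _ => rfl) Subtype.val_injective.injOn
      fun R hR => ⟨⟨R, (mem_powersetCard.1 hR).2⟩, mem_univ _, rfl⟩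

end GroupAverages

section Exchange

variable {K α : Type*} [Field K] [CharZero K] [Fintype α] [DecidableEq α]

theorem expect_perm_sub_mul_eq_zero (g : α → K) {F : Perm α → K} {s p : α}
    (hF : ∀ σ, F (σ * swap s p) = F σ) : 𝔼 σ : Perm α, (g (σ s) - g (σ p)) * F σ = 0 := by
  have hswap : 𝔼 σ : Perm α, g (σ p) * F σ = 𝔼 σ : Perm α, g (σ s) * F σ := by
    rw [← expect_perm_mul_right (fun σ => g (σ s) * F σ) (swap s p)]
    simp only [Perm.mul_apply, swap_apply_left, hF]
  simp only [sub_mul, expect_sub_distrib, hswap, sub_self]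

theorem expect_perm_sub_mean_mul (g : α → K) {F : Perm α → K} {s : α} {T : Finset α}
    (hF : ∀ p ∉ T, ∀ σ, F (σ * swap s p) = F σ) :
    𝔼 σ : Perm α, (g (σ s) - 𝔼 j, g j) * F σ =
      (Fintype.card α : K)⁻¹ * ∑ t ∈ T, 𝔼 σ : Perm α, (g (σ s) - g (σ t)) * F σ := by
  have : Nonempty α := ⟨s⟩
  have hN : (Fintype.card α : K) ≠ 0 := Nat.cast_ne_zero.2 Fintype.card_ne_zero
  have hsum (σ : Perm α) : ∑ p, (g (σ s) - g (σ p)) * F σ =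
      Fintype.card α * ((g (σ s) - 𝔼 j, g j) * F σ) := by
    rw [← sum_mul, sum_sub_distrib, sum_const, Equiv.sum_comp σ g, ← Fintype.card_mul_expect g,
      nsmul_eq_mul, card_univ]
    ring
  rw [sum_subset (subset_univ T) fun p _ hp => expect_perm_sub_mul_eq_zero g (hF p hp),
    ← expect_sum_comm]
  simp only [hsum, ← mul_expect, inv_mul_cancel_left₀ hN]

theorem expect_perm_sub_mul_mul (g h : α → K) {F : Perm α → K} {s t : α}
    (hF : ∀ σ, F (σ * swap s t) = F σ) :
    𝔼 σ : Perm α, (g (σ s) - g (σ t)) * (h (σ t) * F σ) =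
      -(1 / 2) * 𝔼 σ : Perm α, (g (σ s) - g (σ t)) * (h (σ s) - h (σ t)) * F σ := by
  have hswap : 𝔼 σ : Perm α, (g (σ s) - g (σ t)) * (h (σ t) * F σ) =
      𝔼 σ : Perm α, (g (σ t) - g (σ s)) * (h (σ s) * F σ) := by
    rw [← expect_perm_mul_right _ (swap s t)]
    simp only [Perm.mul_apply, swap_apply_left, swap_apply_right, hF]
  have hsplit : 𝔼 σ : Perm α, (g (σ s) - g (σ t)) * (h (σ s) - h (σ t)) * F σ =
      -(𝔼 σ : Perm α, (g (σ t) - g (σ s)) * (h (σ s) * F σ)) -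
        𝔼 σ : Perm α, (g (σ s) - g (σ t)) * (h (σ t) * F σ) := by
    rw [← expect_neg_distrib, ← expect_sub_distrib]
    exact expect_congr rfl fun σ _ => by ring
  rw [hsplit, ← hswap]
  ring

theorem prod_perm_mul_swap_apply {ι M : Type*} [DecidableEq ι] [CommMonoid M] (f : ι → M)
    (σ : Perm ι) {T : Finset ι} {s p : ι} (hs : s ∉ T) (hp : p ∉ T) :
    ∏ i ∈ T, f ((σ * swap s p) i) = ∏ i ∈ T, f (σ i) :=
  prod_congr rfl fun i hi => by
    rw [Perm.mul_apply, swap_apply_of_ne_of_ne (ne_of_mem_of_not_mem hi hs)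
      (ne_of_mem_of_not_mem hi hp)]

theorem expect_perm_sub_mul_prod_nonpos {x : α → ℝ} (hx : ∀ j, 0 ≤ x j) {s t : α} {T : Finset α}
    (hs : s ∉ T) (ht : t ∈ T) :
    𝔼 σ : Perm α, (x (σ s) - x (σ t)) * ∏ i ∈ T, x (σ i) ≤ 0 := by
  have hanti := expect_perm_sub_mul_mul x x (F := fun σ => ∏ i ∈ T.erase t, x (σ i))
    fun σ => prod_perm_mul_swap_apply x σ (fun h => hs (mem_of_mem_erase h)) (notMem_erase t T)
  have hsq : 0 ≤ 𝔼 σ : Perm α, (x (σ s) - x (σ t)) * (x (σ s) - x (σ t)) *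
      ∏ i ∈ T.erase t, x (σ i) :=
    expect_nonneg fun σ _ => mul_nonneg (mul_self_nonneg _) (prod_nonneg fun i _ => hx _)
  have hprod (σ : Perm α) : x (σ t) * ∏ i ∈ T.erase t, x (σ i) = ∏ i ∈ T, x (σ i) :=
    mul_prod_erase T (fun i => x (σ i)) ht
  simp only [hprod] at hanti
  linarith

/-- Sampling without replacement makes the factors negatively correlated. This is Maclaurin's
inequality for the elementary symmetric polynomials. -/
theorem expect_perm_prod_le_pow {x : α → ℝ} (hx : ∀ j, 0 ≤ x j) (T : Finset α) :
    𝔼 σ : Perm α, ∏ i ∈ T, x (σ i) ≤ (𝔼 j, x j) ^ #T := by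
  induction T using Finset.induction_on with
  | empty => simp
  | insert s T hs ih =>
    have hexch := expect_perm_sub_mean_mul x (F := fun σ => ∏ i ∈ T, x (σ i)) (s := s)
      fun p hp σ => prod_perm_mul_swap_apply x σ hs hp
    have hcov : 𝔼 σ : Perm α, (x (σ s) - 𝔼 j, x j) * ∏ i ∈ T, x (σ i) ≤ 0 := by
      rw [hexch]
      exact mul_nonpos_of_nonneg_of_nonpos (by positivity)
        (sum_nonpos fun t ht => expect_perm_sub_mul_prod_nonpos hx hs ht)
    calc 𝔼 σ : Perm α, ∏ i ∈ insert s T, x (σ i)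
        ≤ (𝔼 j, x j) * 𝔼 σ : Perm α, ∏ i ∈ T, x (σ i) := by
          simpa only [prod_insert hs, sub_mul, expect_sub_distrib, ← mul_expect, sub_nonpos]
            using hcov
      _ ≤ (𝔼 j, x j) * (𝔼 j, x j) ^ #T :=
          mul_le_mul_of_nonneg_left ih (expect_nonneg fun j _ => hx j)
      _ = (𝔼 j, x j) ^ #(insert s T) := by rw [card_insert_of_notMem hs, pow_succ']

/-- If `X` is the left side and `c` is the covariance of `g` and `h`, the exchange identities give
`-X / 2 = -X / (2 * N) - c`, by splitting `g (σ a) - g (σ b)` at the mean of `g`. -/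
theorem expect_perm_sub_mul_sub (g h : α → K) {a b : α} (hab : a ≠ b) :
    𝔼 σ : Perm α, (g (σ a) - g (σ b)) * (h (σ a) - h (σ b)) =
      2 / ((Fintype.card α : K) - 1) * ∑ j, (g j - 𝔼 i, g i) * (h j - 𝔼 i, h i) := by
  have : Nontrivial α := ⟨a, b, hab⟩
  have hN : (Fintype.card α : K) ≠ 0 := Nat.cast_ne_zero.2 Fintype.card_ne_zero
  have hN1 : (Fintype.card α : K) - 1 ≠ 0 :=
    sub_ne_zero.2 (Nat.cast_ne_one.2 Fintype.one_lt_card.ne')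
  set X := 𝔼 σ : Perm α, (g (σ a) - g (σ b)) * (h (σ a) - h (σ b)) with hX
  have hanti : 𝔼 σ : Perm α, (g (σ a) - g (σ b)) * (h (σ b) - 𝔼 i, h i) = -(1 / 2) * X := by
    simpa [hX] using expect_perm_sub_mul_mul (F := fun _ => 1) g (fun j => h j - 𝔼 i, h i)
      (s := a) (t := b) fun _ => rfl
  have hexch : 𝔼 σ : Perm α, (g (σ a) - 𝔼 i, g i) * (h (σ b) - 𝔼 i, h i) =
      (Fintype.card α : K)⁻¹ * (-(1 / 2) * X) := by
    rw [expect_perm_sub_mean_mul g (T := {b}) fun p hp σ => ?_, sum_singleton, hanti]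
    rw [Perm.mul_apply, swap_apply_of_ne_of_ne hab.symm (by simpa [eq_comm] using hp)]
  have hcov : 𝔼 σ : Perm α, (g (σ b) - 𝔼 i, g i) * (h (σ b) - 𝔼 i, h i) =
      (Fintype.card α : K)⁻¹ * ∑ j, (g j - 𝔼 i, g i) * (h j - 𝔼 i, h i) := by
    rw [expect_perm_apply (fun j => (g j - 𝔼 i, g i) * (h j - 𝔼 i, h i)),
      Fintype.expect_eq_sum_div_card, div_eq_inv_mul]
  have hsplit : -(1 / 2) * X = (Fintype.card α : K)⁻¹ * (-(1 / 2) * X) -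
      (Fintype.card α : K)⁻¹ * ∑ j, (g j - 𝔼 i, g i) * (h j - 𝔼 i, h i) := by
    rw [← hexch, ← hcov, ← hanti, ← expect_sub_distrib]
    exact expect_congr rfl fun σ _ => by ring
  field_simp at hsplit ⊢
  linear_combination -hsplit

end Exchange

section Multilinear

open RealInnerProductSpace

theorem exists_norm_apply_eq_opNorm {κ E F : Type*} [Fintype κ] [NormedAddCommGroup E]
    [NormedSpace ℝ E] [ProperSpace E] [Nontrivial E] [NormedAddCommGroup F] [NormedSpace ℝ F]
    (f : ContinuousMultilinearMap ℝ (fun _ : κ => E) F) :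
    ∃ a : κ → E, (∀ i, ‖a i‖ = 1) ∧ ‖f a‖ = ‖f‖ := by
  have hcompact : IsCompact (Set.univ.pi fun _ : κ => Metric.sphere (0 : E) 1) :=
    isCompact_univ_pi fun _ => isCompact_sphere 0 1
  have hnonempty : (Set.univ.pi fun _ : κ => Metric.sphere (0 : E) 1).Nonempty :=
    Set.univ_pi_nonempty_iff.2 fun _ => NormedSpace.sphere_nonempty.2 zero_le_one
  obtain ⟨a, ha, hmax⟩ := hcompact.exists_isMaxOn hnonempty f.cont.norm.continuousOn
  simp only [Set.mem_univ_pi, mem_sphere_zero_iff_norm] at ha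
  refine ⟨a, ha, le_antisymm (by simpa [ha] using f.le_opNorm a) ?_⟩
  refine f.opNorm_le_bound (norm_nonneg _) fun v => ?_
  by_cases hv : ∃ i, v i = 0
  · obtain ⟨i, hi⟩ := hv
    rw [f.map_coord_zero i hi, norm_zero]
    positivity
  · simp only [not_exists] at hv
    have hw : (fun i => ‖v i‖⁻¹ • v i) ∈ Set.univ.pi fun _ : κ => Metric.sphere (0 : E) 1 := by
      simpa [norm_smul] using fun i => inv_mul_cancel₀ (norm_ne_zero_iff.2 (hv i))
    calc ‖f v‖ = ‖f fun i => ‖v i‖ • ‖v i‖⁻¹ • v i‖ := by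
          simp only [smul_inv_smul₀ (norm_ne_zero_iff.2 (hv _))]
      _ = (∏ i, ‖v i‖) * ‖f fun i => ‖v i‖⁻¹ • v i‖ := by
          rw [f.map_smul_univ, norm_smul, norm_prod]
          simp only [norm_norm]
      _ ≤ (∏ i, ‖v i‖) * ‖f a‖ := by gcongr; exact hmax hw
      _ = ‖f a‖ * ∏ i, ‖v i‖ := mul_comm _ _

variable {κ E : Type*} [NormedAddCommGroup E] [InnerProductSpace ℝ E]

theorem apply_eq_mul_inner_of_norm_le [CompleteSpace E] {L : E →L[ℝ] ℝ} {u : E} (hu : ‖u‖ = 1)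
    (hL : ‖L‖ ≤ ‖L u‖) (v : E) : L v = L u * ⟪u, v⟫ := by
  set b := (InnerProductSpace.toDual ℝ E).symm L with hb
  have hLb (v : E) : ⟪b, v⟫ = L v := InnerProductSpace.toDual_symm_apply
  have hnorm : ‖b‖ ≤ ‖L u‖ := by simpa [hb] using hL
  have hsq : ‖b - L u • u‖ ^ 2 ≤ 0 := by
    rw [norm_sub_sq_real, inner_smul_right, hLb, norm_smul, hu]
    nlinarith [norm_nonneg b, sq_abs (L u), Real.norm_eq_abs (L u)]
  have hbu : b = L u • u := by
    simpa [sub_eq_zero] using pow_eq_zero_iff two_ne_zero |>.1 (hsq.antisymm (sq_nonneg _))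
  calc L v = ⟪b, v⟫ := (hLb v).symm
    _ = L u * ⟪u, v⟫ := by rw [hbu, real_inner_smul_left]

theorem norm_add_lt_norm_smul_add {u v w : E} (hu : ‖u‖ = 1) (hv : ‖v‖ = 1) (huv : u ≠ v)
    (hu' : 0 ≤ ⟪u, v + w⟫) (hv' : 0 ≤ ⟪v, u + w⟫) :
    ‖u + v + w‖ < ‖(2 / ‖u + v‖) • (u + v) + w‖ := by
  have hsum : ‖u + v‖ ^ 2 = 2 + 2 * ⟪u, v⟫ := by rw [norm_add_sq_real, hu, hv]; ring
  have hdiff : 0 < 2 - 2 * ⟪u, v⟫ := by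
    have := pow_pos (norm_sub_pos_iff.2 huv) 2
    rw [norm_sub_sq_real, hu, hv] at this
    linarith
  have hw : 2 - ‖u + v‖ ^ 2 ≤ ⟪u + v, w⟫ := by
    rw [inner_add_right] at hu' hv'
    rw [hsum, inner_add_left]
    linarith [real_inner_comm u v]
  have hpos : 0 < ‖u + v‖ := norm_pos_iff.2 fun h => by simp [h] at hw; linarith
  obtain ⟨c, hc⟩ : ∃ c, c = 2 / ‖u + v‖ := ⟨_, rfl⟩
  have hc1 : 1 < c := by
    rw [hc, one_lt_div hpos]
    nlinarith
  refine lt_of_pow_lt_pow_left₀ 2 (norm_nonneg _) ?_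
  rw [← hc, norm_add_sq_real (u + v) w, norm_add_sq_real (c • (u + v)) w, norm_smul, mul_pow,
    real_inner_smul_left, Real.norm_eq_abs, sq_abs]
  nlinarith [mul_nonneg (sub_nonneg.2 hc1.le) (sub_nonneg.2 hw),
    mul_nonneg (sq_nonneg (c - 1)) (sq_nonneg ‖u + v‖)]

variable [Fintype κ]

/-- The tuples of unit vectors at which a multilinear form attains its norm. -/
def normingTuples (f : ContinuousMultilinearMap ℝ (fun _ : κ => E) ℝ) : Set (κ → E) :=
  {a | (∀ i, ‖a i‖ = 1) ∧ ‖f a‖ = ‖f‖}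

theorem isCompact_normingTuples [ProperSpace E]
    (f : ContinuousMultilinearMap ℝ (fun _ : κ => E) ℝ) : IsCompact (normingTuples f) := by
  have hsphere : IsCompact (Set.univ.pi fun _ : κ => Metric.sphere (0 : E) 1) :=
    isCompact_univ_pi fun _ => isCompact_sphere 0 1
  convert hsphere.inter_right (isClosed_eq f.cont.norm (continuous_const (y := ‖f‖))) using 1
  ext a
  simp [normingTuples]

variable {f : ContinuousMultilinearMap ℝ (fun _ : κ => E) ℝ} {a : κ → E}

section Update

variable [DecidableEq κ]

theorem apply_update_eq_mul_inner [CompleteSpace E] (ha : a ∈ normingTuples f) (s : κ) (v : E) :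
    f (Function.update a s v) = f a * ⟪a s, v⟫ := by
  have happly (v : E) : f.toContinuousLinearMap a s v = f (Function.update a s v) := rfl
  have hself : f.toContinuousLinearMap a s (a s) = f a := by
    rw [happly, Function.update_eq_self]
  have hnorm : ‖f.toContinuousLinearMap a s‖ ≤ ‖f.toContinuousLinearMap a s (a s)‖ := by
    refine ContinuousLinearMap.opNorm_le_bound _ (norm_nonneg _) fun v => ?_
    have hprod : ∏ i, ‖Function.update a s v i‖ = ‖v‖ := by
      rw [Fintype.prod_eq_single s fun i hi => by rw [Function.update_of_ne hi, ha.1],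
        Function.update_self]
    rw [hself, ha.2, happly, ← hprod]
    exact f.le_opNorm _
  rw [← happly, apply_eq_mul_inner_of_norm_le (ha.1 s) hnorm, hself]

theorem apply_update_update_add [CompleteSpace E] (hf : ∀ (ρ : Perm κ) (v : κ → E), f (v ∘ ρ) = f v)
    (ha : a ∈ normingTuples f) {s t : κ} (hst : s ≠ t) :
    f (Function.update (Function.update a s (a s + a t)) t (a s + a t)) =
      f a * ‖a s + a t‖ ^ 2 := by
  set p := a s + a t with hp
  have hswap : Function.update (Function.update a t p) s (a t) =
      Function.update a s p ∘ swap s t := by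
    rw [comp_swap_eq_update, Function.update_self, Function.update_of_ne hst.symm,
      Function.update_comm hst, Function.update_idem]
  calc f (Function.update (Function.update a s p) t p)
      = f (Function.update (Function.update a t p) s (a s + a t)) := by
        rw [Function.update_comm hst]
    _ = f (Function.update a t p) + f (Function.update a s p) := by
        rw [f.map_update_add, hswap, hf, Function.update_comm hst.symm, Function.update_eq_self]
    _ = f a * ‖p‖ ^ 2 := by
        rw [apply_update_eq_mul_inner ha, apply_update_eq_mul_inner ha, ← mul_add,
          ← inner_add_left, add_comm (a t), ← hp, real_inner_self_eq_norm_sq]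

theorem update_neg_mem_normingTuples (ha : a ∈ normingTuples f) (t : κ) :
    Function.update a t (-a t) ∈ normingTuples f := by
  have hneg : f (Function.update a t (-a t)) = -f (Function.update a t (a t)) :=
    f.toMultilinearMap.map_update_neg a t (a t)
  refine ⟨fun i => ?_, by rw [hneg, norm_neg, Function.update_eq_self, ha.2]⟩
  obtain rfl | hi := eq_or_ne i t
  · rw [Function.update_self, norm_neg, ha.1]
  · rw [Function.update_of_ne hi, ha.1]

theorem update_update_smul_add_mem_normingTuples [CompleteSpace E]
    (hf : ∀ (ρ : Perm κ) (v : κ → E), f (v ∘ ρ) = f v) (ha : a ∈ normingTuples f) {s t : κ}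
    (hst : s ≠ t) (hp : a s + a t ≠ 0) :
    Function.update (Function.update a s (‖a s + a t‖⁻¹ • (a s + a t))) t
      (‖a s + a t‖⁻¹ • (a s + a t)) ∈ normingTuples f := by
  have hunit : ‖‖a s + a t‖⁻¹ • (a s + a t)‖ = 1 := norm_smul_inv_norm (𝕜 := ℝ) hp
  refine ⟨fun i => ?_, ?_⟩
  · simp only [Function.update_apply]
    split_ifs
    exacts [hunit, hunit, ha.1 i]
  · rw [f.map_update_smul, Function.update_comm hst, f.map_update_smul,
      Function.update_comm hst.symm, apply_update_update_add hf ha hst, norm_smul, norm_smul,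
      norm_mul, ha.2, norm_pow, norm_inv, norm_norm]
    field_simp [norm_ne_zero_iff.2 hp]

theorem inner_sum_erase_nonneg (ha : a ∈ normingTuples f)
    (hmax : ∀ b ∈ normingTuples f, ‖∑ i, b i‖ ≤ ‖∑ i, a i‖) (t : κ) :
    0 ≤ ⟪a t, ∑ i ∈ univ.erase t, a i⟫ := by
  have hflip := hmax _ (update_neg_mem_normingTuples ha t)
  rw [sum_update_of_mem (mem_univ t), ← erase_eq, ← add_sum_erase univ a (mem_univ t)] at hflip
  have hsq := pow_le_pow_left₀ (norm_nonneg _) hflip 2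
  rw [norm_add_sq_real, norm_add_sq_real, norm_neg, inner_neg_left] at hsq
  linarith

end Update

theorem eq_of_forall_norm_sum_le [CompleteSpace E]
    (hf : ∀ (ρ : Perm κ) (v : κ → E), f (v ∘ ρ) = f v) (ha : a ∈ normingTuples f)
    (hmax : ∀ b ∈ normingTuples f, ‖∑ i, b i‖ ≤ ‖∑ i, a i‖) (s t : κ) : a s = a t := by
  classical
  by_contra hne
  have hst : s ≠ t := fun h => hne (congrArg a h)
  set w := ∑ i ∈ (univ.erase t).erase s, a i with hw
  have hsum (b : κ → E) : ∑ i, b i = b s + b t + ∑ i ∈ (univ.erase t).erase s, b i := by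
    rw [add_comm (b s), add_assoc, add_sum_erase _ b (mem_erase.2 ⟨hst, mem_univ s⟩),
      add_sum_erase _ b (mem_univ t)]
  have hs : 0 ≤ ⟪a s, a t + w⟫ := by
    rw [hw, erase_right_comm, add_sum_erase _ a (mem_erase.2 ⟨hst.symm, mem_univ t⟩)]
    exact inner_sum_erase_nonneg ha hmax s
  have ht : 0 ≤ ⟪a t, a s + w⟫ := by
    rw [hw, add_sum_erase _ a (mem_erase.2 ⟨hst, mem_univ s⟩)]
    exact inner_sum_erase_nonneg ha hmax t
  have hlonger := norm_add_lt_norm_smul_add (ha.1 s) (ha.1 t) hne hs ht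
  have hp : a s + a t ≠ 0 := fun h => by simp [h] at hlonger
  have hrest (q : E) : ∑ i ∈ (univ.erase t).erase s,
      Function.update (Function.update a s q) t q i = w := by
    refine sum_congr rfl fun i hi => ?_
    rw [Function.update_of_ne (ne_of_mem_erase (mem_of_mem_erase hi)),
      Function.update_of_ne (ne_of_mem_erase hi)]
  refine (hmax _ (update_update_smul_add_mem_normingTuples hf ha hst hp)).not_gt ?_
  rw [hsum a, hsum, hrest, Function.update_self, Function.update_of_ne hst, Function.update_self,
    ← two_smul ℝ (_ • _), smul_smul, ← div_eq_mul_inv]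
  exact hlonger

/-- Banach's theorem. Among the norming tuples, one whose sum is longest is constant: two different
entries could both be replaced by their normalised sum. -/
theorem exists_norm_apply_const_eq_opNorm [Nonempty κ] [FiniteDimensional ℝ E] [Nontrivial E]
    (hf : ∀ (ρ : Perm κ) (v : κ → E), f (v ∘ ρ) = f v) :
    ∃ x : E, ‖x‖ = 1 ∧ ‖f fun _ => x‖ = ‖f‖ := by
  have : ProperSpace E := FiniteDimensional.proper_real E
  have hnonempty : (normingTuples f).Nonempty := exists_norm_apply_eq_opNorm f
  obtain ⟨a, ha, hmax⟩ := (isCompact_normingTuples f).exists_isMaxOn hnonempty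
    (f := fun a => ‖∑ i, a i‖) (by fun_prop)
  obtain ⟨s⟩ := ‹Nonempty κ›
  have hconst : a = fun _ => a s :=
    funext fun t => eq_of_forall_norm_sum_le hf ha (fun b hb => hmax hb) t s
  exact ⟨a s, ha.1 s, by rw [← hconst, ha.2]⟩

end Multilinear

section Permanent

variable {κ α : Type*} [Fintype κ] [Fintype α]

theorem abs_expect_embedding_prod_le_sqrt_pow (x : α → ℝ) :
    |𝔼 u : κ ↪ α, ∏ i, x (u i)| ≤ √(𝔼 j, x j ^ 2) ^ Fintype.card κ := by
  classical
  obtain hempty | ⟨⟨e⟩⟩ := isEmpty_or_nonempty (κ ↪ α)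
  · rw [univ_eq_empty, expect_empty, abs_zero]
    positivity
  have hmean : 𝔼 j, |x j| ≤ √(𝔼 j, x j ^ 2) := by
    have hcs := expect_mul_sq_le_sq_mul_sq univ (fun j => |x j|) fun _ => 1
    obtain hα | hα := isEmpty_or_nonempty α
    · simp
    · simpa using Real.le_sqrt_of_sq_le (by simpa using hcs)
  calc |𝔼 u : κ ↪ α, ∏ i, x (u i)| ≤ 𝔼 u : κ ↪ α, ∏ i, |x (u i)| := by
        simpa only [abs_prod] using abs_expect_le univ fun u : κ ↪ α => ∏ i, x (u i)
    _ = 𝔼 σ : Perm α, ∏ i ∈ univ.map e, |x (σ i)| := by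
        rw [← expect_perm_embedding (fun u => ∏ i, |x (u i)|) e]
        simp only [prod_map, Function.Embedding.trans_apply, coe_toEmbedding]
    _ ≤ (𝔼 j, |x j|) ^ #(univ.map e) := expect_perm_prod_le_pow (fun j => abs_nonneg (x j)) _
    _ ≤ √(𝔼 j, x j ^ 2) ^ Fintype.card κ := by
        rw [card_map, card_univ]
        exact pow_le_pow_left₀ (expect_nonneg fun j _ => abs_nonneg _) hmean _

/-- The normalised permanent as a multilinear form in its columns, which carry the Euclidean norm so
that Banach's theorem applies. -/
noncomputable def permanentForm (κ α : Type*) [Fintype κ] [Fintype α] :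
    ContinuousMultilinearMap ℝ (fun _ : κ => EuclideanSpace ℝ α) ℝ :=
  (Fintype.card (κ ↪ α) : ℝ)⁻¹ • ∑ u : κ ↪ α,
    (ContinuousMultilinearMap.mkPiAlgebra ℝ κ ℝ).compContinuousLinearMap
      fun i => EuclideanSpace.proj (u i)

theorem permanentForm_apply (a : κ → EuclideanSpace ℝ α) :
    permanentForm κ α a = 𝔼 u : κ ↪ α, ∏ i, a i (u i) := by
  simp [permanentForm, Fintype.expect_eq_sum_div_card, div_eq_inv_mul]

theorem permanentForm_comp_perm (ρ : Perm κ) (a : κ → EuclideanSpace ℝ α) :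
    permanentForm κ α (a ∘ ρ) = permanentForm κ α a := by
  rw [permanentForm_apply, permanentForm_apply]
  refine Fintype.expect_equiv (Equiv.embeddingCongr ρ (Equiv.refl α)) _ _ fun u => ?_
  exact Fintype.prod_equiv ρ _ _ fun i => by simp

theorem norm_permanentForm_le [Nonempty κ] [Nonempty α] :
    ‖permanentForm κ α‖ ≤ √(Fintype.card α : ℝ)⁻¹ ^ Fintype.card κ := by
  obtain ⟨x, hx, hnorm⟩ := exists_norm_apply_const_eq_opNorm
    (permanentForm_comp_perm (κ := κ) (α := α))
  rw [← hnorm, permanentForm_apply, Real.norm_eq_abs]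
  have hx' : 𝔼 j, x j ^ 2 = (Fintype.card α : ℝ)⁻¹ := by
    rw [Fintype.expect_eq_sum_div_card, ← EuclideanSpace.real_norm_sq_eq, hx, one_pow, one_div]
  exact hx' ▸ abs_expect_embedding_prod_le_sqrt_pow x

/-- The inequality of Carlen, Lieb and Loss: the Hadamard inequality for permanents. -/
theorem abs_expect_embedding_prod_le_prod_sqrt (a : κ → α → ℝ) :
    |𝔼 u : κ ↪ α, ∏ i, a i (u i)| ≤ ∏ i, √(𝔼 j, a i j ^ 2) := by
  obtain hκ | hκ := isEmpty_or_nonempty κ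
  · simp
  obtain hα | hα := isEmpty_or_nonempty α
  · have : IsEmpty (κ ↪ α) := ⟨fun e => hα.elim (e hκ.some)⟩
    simp
  have hcol (i : κ) : √(Fintype.card α : ℝ)⁻¹ * ‖WithLp.toLp 2 (a i)‖ = √(𝔼 j, a i j ^ 2) := by
    rw [EuclideanSpace.norm_eq, ← Real.sqrt_mul (by positivity),
      Fintype.expect_eq_sum_div_card, div_eq_inv_mul]
    simp
  calc |𝔼 u : κ ↪ α, ∏ i, a i (u i)|
      = ‖permanentForm κ α fun i => WithLp.toLp 2 (a i)‖ := by
        rw [permanentForm_apply, Real.norm_eq_abs]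
    _ ≤ √(Fintype.card α : ℝ)⁻¹ ^ Fintype.card κ * ∏ i, ‖WithLp.toLp 2 (a i)‖ :=
        (permanentForm κ α).le_of_opNorm_le norm_permanentForm_le _
    _ = ∏ i, √(𝔼 j, a i j ^ 2) := by
        rw [← card_univ (α := κ), ← prod_const, ← prod_mul_distrib]
        exact prod_congr rfl fun i _ => hcol i

end Permanent

section MixedMeans

variable {α γ K : Type*} [RCLike K]

/-- The difference, in column `τ r`, of the entries in the random rows chosen at `s` and at `t`. -/
def entryDiff (z : α → γ → K) (ι : γ ↪ α) (s t r : γ) (σ : Perm α) (τ : Perm γ) : K :=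
  z (σ (ι s)) (τ r) - z (σ (ι t)) (τ r)

/-- `Φ σ τ` depends only on the rows and the columns which `σ` and `τ` choose at the indices
in `C`. -/
def IsLocalAt {M : Type*} (ι : γ ↪ α) (C : Finset γ) (Φ : Perm α → Perm γ → M) : Prop :=
  ∀ ⦃σ σ' τ τ'⦄, (∀ i ∈ C, σ (ι i) = σ' (ι i)) → (∀ i ∈ C, τ i = τ' i) → Φ σ τ = Φ σ' τ'

section Local

variable {M : Type*} {ι : γ ↪ α} {C : Finset γ} {Φ Ψ : Perm α → Perm γ → M}

theorem isLocalAt_entryDiff {z : α → γ → K} {s t r : γ} (hs : s ∈ C) (ht : t ∈ C) (hr : r ∈ C) :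
    IsLocalAt ι C (entryDiff z ι s t r) := fun σ σ' τ τ' hσ hτ => by
  rw [entryDiff, entryDiff, hσ s hs, hσ t ht, hτ r hr]

theorem IsLocalAt.mul [Mul M] (hΦ : IsLocalAt ι C Φ) (hΨ : IsLocalAt ι C Ψ) :
    IsLocalAt ι C (Φ * Ψ) := fun _ _ _ _ hσ hτ => congrArg₂ (· * ·) (hΦ hσ hτ) (hΨ hσ hτ)

theorem IsLocalAt.mul_swap [DecidableEq α] (hΦ : IsLocalAt ι C Φ) {σ : Perm α} {τ : Perm γ}
    {a b : α} (ha : a ∉ C.map ι) (hb : b ∉ C.map ι) : Φ (σ * swap a b) τ = Φ σ τ :=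
  hΦ (fun i hi => by
    have hi' := mem_map_of_mem ι hi
    rw [Perm.mul_apply, swap_apply_of_ne_of_ne (ne_of_mem_of_not_mem hi' ha)
      (ne_of_mem_of_not_mem hi' hb)]) fun _ _ => rfl

end Local

variable [Fintype α] [DecidableEq γ]

/-- The entry in column `τ i` of a random row if `i ∈ Q`, and the mean of that column otherwise.
The permutations `σ` and `τ` are the randomness; `ι` makes the index `i` of a column an index of a
row, so that different `i` choose different rows. -/
noncomputable def mix (z : α → γ → K) (ι : γ ↪ α) (Q : Finset γ) (σ : Perm α) (τ : Perm γ)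
    (i : γ) : K :=
  if i ∈ Q then z (σ (ι i)) (τ i) else 𝔼 j, z j (τ i)

/-- The average over `σ` and `τ` of `Φ σ τ` times the product over the indices outside `C` of
random entries (at the indices in `Q`) and column means (elsewhere). -/
noncomputable def mixedMean [DecidableEq α] [Fintype γ] (z : α → γ → K) (ι : γ ↪ α)
    (C Q : Finset γ) (Φ : Perm α → Perm γ → K) : K :=
  𝔼 τ : Perm γ, 𝔼 σ : Perm α, Φ σ τ * ∏ i ∈ Cᶜ, mix z ι Q σ τ i

variable {z : α → γ → K} {ι : γ ↪ α} {C Q : Finset γ} {σ : Perm α} {τ : Perm γ} {i s t : γ}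

theorem mix_of_mem (hi : i ∈ Q) : mix z ι Q σ τ i = z (σ (ι i)) (τ i) := if_pos hi

theorem mix_of_notMem (hi : i ∉ Q) : mix z ι Q σ τ i = 𝔼 j, z j (τ i) := if_neg hi

theorem mix_insert_of_ne (hi : i ≠ s) : mix z ι (insert s Q) σ τ i = mix z ι Q σ τ i := by
  simp [mix, hi]

theorem mix_erase_of_ne (hi : i ≠ s) : mix z ι (Q.erase s) σ τ i = mix z ι Q σ τ i := by
  simp [mix, hi]

theorem prod_mix_mul_swap [DecidableEq α] {D : Finset γ} {a b : α} (ha : a ∉ (D ∩ Q).map ι)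
    (hb : b ∉ (D ∩ Q).map ι) :
    ∏ i ∈ D, mix z ι Q (σ * swap a b) τ i = ∏ i ∈ D, mix z ι Q σ τ i := by
  refine prod_congr rfl fun i hi => ?_
  by_cases hQ : i ∈ Q
  · have hi' := mem_map_of_mem ι (mem_inter.2 ⟨hi, hQ⟩)
    rw [mix_of_mem hQ, mix_of_mem hQ, Perm.mul_apply, swap_apply_of_ne_of_ne
      (ne_of_mem_of_not_mem hi' ha) (ne_of_mem_of_not_mem hi' hb)]
  · rw [mix_of_notMem hQ, mix_of_notMem hQ]

variable [Fintype γ]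

theorem compl_eq_insert_compl_insert (hs : s ∉ C) : Cᶜ = insert s (insert s C)ᶜ := by
  rw [compl_insert, insert_erase (mem_compl.2 hs)]

theorem prod_mix_insert_sub_prod_mix (hsC : s ∉ C) (hsQ : s ∉ Q) :
    ∏ i ∈ Cᶜ, mix z ι (insert s Q) σ τ i - ∏ i ∈ Cᶜ, mix z ι Q σ τ i =
      (z (σ (ι s)) (τ s) - 𝔼 j, z j (τ s)) * ∏ i ∈ (insert s C)ᶜ, mix z ι Q σ τ i := by
  have hs : s ∉ (insert s C)ᶜ := by simp
  rw [compl_eq_insert_compl_insert hsC, prod_insert hs, prod_insert hs,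
    mix_of_mem (mem_insert_self s Q), mix_of_notMem hsQ, sub_mul,
    prod_congr rfl fun i hi => mix_insert_of_ne (ne_of_mem_of_not_mem hi hs)]

variable [DecidableEq α]

/-- Exchanging the row chosen at `s` for the one chosen at an index `t ∈ Q` is antisymmetric in
`entryDiff z ι s t s`, which turns the entry at `t` into a second difference. -/
theorem expect_entryDiff_mul_of_mem {Φ : Perm α → Perm γ → K} (hΦ : IsLocalAt ι C Φ) (hsC : s ∉ C)
    (htC : t ∉ C) (hst : s ≠ t) (htQ : t ∈ Q) :
    𝔼 σ, entryDiff z ι s t s σ τ * (Φ σ τ * ∏ i ∈ (insert s C)ᶜ, mix z ι Q σ τ i) =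
      -(1 / 2) * 𝔼 σ, (entryDiff z ι s t s * entryDiff z ι s t t * Φ) σ τ *
        ∏ i ∈ (insert t (insert s C))ᶜ, mix z ι (Q.erase t) σ τ i := by
  set D := (insert t (insert s C))ᶜ with hD
  have htD : t ∉ D := by simp [hD]
  have hsD : s ∉ D := by simp [hD]
  have hprod (σ : Perm α) : ∏ i ∈ (insert s C)ᶜ, mix z ι Q σ τ i =
      z (σ (ι t)) (τ t) * ∏ i ∈ D, mix z ι (Q.erase t) σ τ i := by
    rw [compl_eq_insert_compl_insert (s := t) (by simp [hst.symm, htC]), prod_insert htD,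
      mix_of_mem htQ]
    exact congrArg _ <| prod_congr rfl fun i hi =>
      (mix_erase_of_ne (ne_of_mem_of_not_mem hi htD)).symm
  have hanti := expect_perm_sub_mul_mul (fun j => z j (τ s)) (fun j => z j (τ t))
    (F := fun σ => Φ σ τ * ∏ i ∈ D, mix z ι (Q.erase t) σ τ i) (s := ι s) (t := ι t) fun σ => by
      rw [hΦ.mul_swap (by simpa), prod_mix_mul_swap] <;> simp [hsD, htD, htC]
  simp only [hprod, mul_left_comm (Φ _ τ)]
  refine hanti.trans (congrArg _ <| expect_congr rfl fun σ _ => ?_)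
  simp only [Pi.mul_apply, entryDiff, mul_assoc]

theorem mixedMean_insert_sub {Φ : Perm α → Perm γ → K} (hΦ : IsLocalAt ι C Φ) (hQ : Disjoint Q C)
    (hsC : s ∉ C) (hsQ : s ∉ Q) :
    mixedMean z ι C (insert s Q) Φ - mixedMean z ι C Q Φ =
      (Fintype.card α : K)⁻¹ *
        (∑ t ∈ C, mixedMean z ι (insert s C) Q (entryDiff z ι s t s * Φ) -
          1 / 2 * ∑ t ∈ Q, mixedMean z ι (insert t (insert s C)) (Q.erase t)
            (entryDiff z ι s t s * entryDiff z ι s t t * Φ)) := by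
  set F : Perm γ → Perm α → K := fun τ σ => Φ σ τ * ∏ i ∈ (insert s C)ᶜ, mix z ι Q σ τ i with hF
  have hswap (τ : Perm γ) : ∀ p ∉ (C ∪ Q).map ι, ∀ σ, F τ (σ * swap (ι s) p) = F τ σ := by
    intro p hp σ
    rw [map_union, mem_union, not_or] at hp
    simp only [hF]
    rw [hΦ.mul_swap (by simpa) hp.1, prod_mix_mul_swap (by simp)]
    exact fun h => hp.2 (map_subset_map.2 inter_subset_right h)
  calc mixedMean z ι C (insert s Q) Φ - mixedMean z ι C Q Φ
      = 𝔼 τ, 𝔼 σ, (z (σ (ι s)) (τ s) - 𝔼 j, z j (τ s)) * F τ σ := by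
        simp only [mixedMean, ← expect_sub_distrib, ← mul_sub, hF,
          prod_mix_insert_sub_prod_mix hsC hsQ, mul_left_comm (Φ _ _)]
    _ = 𝔼 τ, (Fintype.card α : K)⁻¹ *
          (∑ t ∈ C, 𝔼 σ, entryDiff z ι s t s σ τ * F τ σ +
            ∑ t ∈ Q, 𝔼 σ, entryDiff z ι s t s σ τ * F τ σ) := by
        refine expect_congr rfl fun τ _ => ?_
        rw [expect_perm_sub_mean_mul (fun j => z j (τ s)) (hswap τ), sum_map, sum_union hQ.symm]
        rfl
    _ = _ := by
        rw [← mul_expect, expect_add_distrib, expect_sum_comm, expect_sum_comm, mul_sum _ _ (1 / 2),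
          sub_eq_add_neg, ← sum_neg_distrib]
        congr 2
        · simp only [mixedMean, Pi.mul_apply, mul_assoc, hF]
        · refine sum_congr rfl fun t ht => ?_
          rw [mixedMean, ← neg_mul, mul_expect]
          exact expect_congr rfl fun τ _ => expect_entryDiff_mul_of_mem hΦ hsC
            (disjoint_left.1 hQ ht) (ne_of_mem_of_not_mem ht hsQ).symm ht

end MixedMeans

section ConditionalMeans

variable {α κ : Type*} [Fintype α] [DecidableEq α]

/-- The conditional expectation of `h σ`, for a uniformly random permutation `σ`, given the values
of `σ` on `D`: the permutations which agree with `σ` on `D` are the products of `σ` with a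
permutation of the complement of `D`. -/
noncomputable def condMean (D : Finset α) (h : Perm α → ℝ) (σ : Perm α) : ℝ :=
  𝔼 ρ : Perm {p // p ∉ D}, h (σ * Perm.ofSubtype ρ)

theorem expect_condMean (D : Finset α) (h : Perm α → ℝ) : 𝔼 σ, condMean D h σ = 𝔼 σ, h σ := by
  simp only [condMean, expect_comm (s := univ (α := Perm α)), expect_perm_mul_right,
    Fintype.expect_const]

theorem condMean_mul {D : Finset α} {A : Perm α → ℝ} {σ : Perm α}
    (hA : ∀ ρ : Perm {p // p ∉ D}, A (σ * Perm.ofSubtype ρ) = A σ) (h : Perm α → ℝ) :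
    condMean D (fun σ => A σ * h σ) σ = A σ * condMean D h σ := by
  simp only [condMean, hA, mul_expect]

theorem expect_mul_le_expect_mul_of_condMean_le {D : Finset α} {A g h : Perm α → ℝ} (hA0 : 0 ≤ A)
    (hA : ∀ σ (ρ : Perm {p // p ∉ D}), A (σ * Perm.ofSubtype ρ) = A σ)
    (hgh : ∀ σ, condMean D g σ ≤ h σ) : 𝔼 σ, A σ * g σ ≤ 𝔼 σ, A σ * h σ := by
  rw [← expect_condMean D]
  refine expect_le_expect fun σ _ => ?_
  rw [condMean_mul (hA σ)]
  exact mul_le_mul_of_nonneg_left (hgh σ) (hA0 σ)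

theorem expect_notMem_apply (D : Finset α) (f : α → ℝ) (σ : Perm α) :
    𝔼 p : {p // p ∉ D}, f (σ p) = 𝔼 j ∈ (D.map σ.toEmbedding)ᶜ, f j :=
  expect_bij (fun p _ => σ p) (fun p _ => by simpa using p.2) (fun p _ => rfl)
    (fun p _ q _ h => Subtype.ext (σ.injective h))
    fun j hj => ⟨⟨σ.symm j, by simpa using hj⟩, mem_univ _, σ.apply_symm_apply j⟩

theorem condMean_prod_le_pow {x : α → ℝ} (hx : ∀ j, 0 ≤ x j) {D Q : Finset α} (hQ : Disjoint Q D)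
    (σ : Perm α) :
    condMean D (fun σ => ∏ i ∈ Q, x (σ i)) σ ≤ (𝔼 j ∈ (D.map σ.toEmbedding)ᶜ, x j) ^ #Q := by
  have hQD : ∀ i ∈ Q, i ∉ D := fun _ hi => disjoint_left.1 hQ hi
  have hcard : #(Q.subtype (· ∉ D)) = #Q := by rw [card_subtype, filter_true_of_mem hQD]
  rw [← expect_notMem_apply, ← hcard]
  refine le_of_eq_of_le (expect_congr rfl fun ρ _ => ?_)
    (expect_perm_prod_le_pow (fun p : {p // p ∉ D} => hx (σ p)) (Q.subtype (· ∉ D)))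
  simp only [← prod_subtype_of_mem _ hQD, Perm.mul_apply, Perm.ofSubtype_apply_coe]

theorem condMean_prod_le_prod_sqrt {D : Finset α} {e : κ ↪ α} {Q : Finset κ}
    (hQ : ∀ i ∈ Q, e i ∉ D) (f : κ → α → ℝ) (σ : Perm α) :
    condMean D (fun σ => ∏ i ∈ Q, f i (σ (e i))) σ ≤
      ∏ i ∈ Q, √(𝔼 j ∈ (D.map σ.toEmbedding)ᶜ, f i j ^ 2) := by
  classical
  let e' : Q ↪ {p // p ∉ D} :=
    ⟨fun i => ⟨e i, hQ i i.2⟩, fun i j h => Subtype.ext (e.injective (congrArg Subtype.val h))⟩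
  let a : Q → {p // p ∉ D} → ℝ := fun i p => f i (σ p)
  calc condMean D (fun σ => ∏ i ∈ Q, f i (σ (e i))) σ
      = 𝔼 ρ : Perm {p // p ∉ D}, ∏ i, a i (e'.trans ρ.toEmbedding i) := by
        refine expect_congr rfl fun ρ _ => ?_
        refine (prod_coe_sort Q _).symm.trans <| prod_congr rfl fun i _ => ?_
        exact congrArg (fun p => f i (σ p)) (Perm.ofSubtype_apply_coe ρ (e' i))
    _ = 𝔼 u : Q ↪ {p // p ∉ D}, ∏ i, a i (u i) :=
        expect_perm_embedding (fun u => ∏ i, a i (u i)) e'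
    _ ≤ ∏ i, √(𝔼 p, a i p ^ 2) := (le_abs_self _).trans (abs_expect_embedding_prod_le_prod_sqrt a)
    _ = _ := by
        refine Eq.trans (prod_congr rfl fun i _ => ?_) (prod_coe_sort Q _)
        exact congrArg _ (expect_notMem_apply D (fun j => f i j ^ 2) σ)

end ConditionalMeans

section NormBound

theorem expect_mul_le_sqrt_mul_sqrt {ι : Type*} [Fintype ι] (f g : ι → ℝ) :
    𝔼 i, f i * g i ≤ √(𝔼 i, f i ^ 2) * √(𝔼 i, g i ^ 2) := by
  rw [← Real.sqrt_mul (expect_nonneg fun _ _ => sq_nonneg _)]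
  exact Real.le_sqrt_of_sq_le (expect_mul_sq_le_sq_mul_sq _ _ _)

/-- Cauchy–Schwarz separates the two products, and Maclaurin's inequality bounds the first. -/
theorem condMean_prod_sqrt_mul_prod_le {γ : Type*} [Fintype γ] [DecidableEq γ] {V : γ → ℝ}
    (hV : ∀ r, 0 ≤ V r) (m : γ → ℝ) {C Q : Finset γ} (hQ : Disjoint Q C) (T : Finset γ) {k : ℝ}
    {τ : Perm γ} (hk : 𝔼 r ∈ (C.map τ.toEmbedding)ᶜ, V r ≤ k) :
    condMean C (fun τ => (∏ i ∈ Q, √(V (τ i))) * ∏ i ∈ T, m (τ i)) τ ≤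
      √k ^ #Q * √(condMean C (fun τ => ∏ i ∈ T, m (τ i) ^ 2) τ) := by
  have hmean : 0 ≤ 𝔼 r ∈ (C.map τ.toEmbedding)ᶜ, V r := expect_nonneg fun r _ => hV r
  refine (expect_mul_le_sqrt_mul_sqrt _ _).trans ?_
  simp only [← prod_pow, Real.sq_sqrt (hV _)]
  refine mul_le_mul_of_nonneg_right ?_ (Real.sqrt_nonneg _)
  rw [Real.sqrt_le_left (by positivity), ← pow_mul, mul_comm, pow_mul,
    Real.sq_sqrt (hmean.trans hk)]
  exact (condMean_prod_le_pow hV hQ τ).trans (pow_le_pow_left₀ hmean hk _)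

variable {α γ K : Type*} [RCLike K] {z : α → γ → K} {ι : γ ↪ α} {C Q : Finset γ}

theorem IsLocalAt.mul_ofSubtype_left {M : Type*} [DecidableEq α] {Φ : Perm α → Perm γ → M}
    (hΦ : IsLocalAt ι C Φ) (σ : Perm α) (τ : Perm γ) (ρ : Perm {p // p ∉ C.map ι}) :
    Φ (σ * Perm.ofSubtype ρ) τ = Φ σ τ :=
  hΦ (fun i hi => by
    rw [Perm.mul_apply, Perm.ofSubtype_apply_of_not_mem ρ (not_not.2 (mem_map_of_mem ι hi))])
    fun _ _ => rfl

variable [DecidableEq γ]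

theorem IsLocalAt.mul_ofSubtype_right {M : Type*} {Φ : Perm α → Perm γ → M} (hΦ : IsLocalAt ι C Φ)
    (σ : Perm α) (τ : Perm γ) (ρ : Perm {r // r ∉ C}) :
    Φ σ (τ * Perm.ofSubtype ρ) = Φ σ τ :=
  hΦ (fun _ _ => rfl) fun i hi => by
    rw [Perm.mul_apply, Perm.ofSubtype_apply_of_not_mem ρ (not_not.2 hi)]

variable [Fintype α] [Fintype γ]

theorem norm_prod_mix (hQ : Disjoint Q C) (σ : Perm α) (τ : Perm γ) :
    ‖∏ i ∈ Cᶜ, mix z ι Q σ τ i‖ =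
      (∏ i ∈ Q, ‖z (σ (ι i)) (τ i)‖) * ∏ i ∈ Cᶜ \ Q, ‖𝔼 j, z j (τ i)‖ := by
  rw [norm_prod, ← prod_sdiff (subset_compl_iff_disjoint_right.2 hQ), mul_comm]
  exact congrArg₂ _ (prod_congr rfl fun i hi => by rw [mix_of_mem hi])
    (prod_congr rfl fun i hi => by rw [mix_of_notMem (mem_sdiff.1 hi).2])

variable [DecidableEq α]

theorem norm_expect_mul_prod_mix_le {Φ : Perm α → Perm γ → K}
    (hΦ : IsLocalAt ι C fun σ τ => ‖Φ σ τ‖) (hQ : Disjoint Q C) (τ : Perm γ) :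
    ‖𝔼 σ, Φ σ τ * ∏ i ∈ Cᶜ, mix z ι Q σ τ i‖ ≤
      𝔼 σ, ‖Φ σ τ‖ * ((∏ i ∈ Q, √(𝔼 j ∈ ((C.map ι).map σ.toEmbedding)ᶜ, ‖z j (τ i)‖ ^ 2)) *
        ∏ i ∈ Cᶜ \ Q, ‖𝔼 j, z j (τ i)‖) := by
  refine (RCLike.norm_expect_le (K := K)).trans ?_
  simp only [norm_mul, norm_prod_mix hQ, ← mul_assoc, ← expect_mul]
  refine mul_le_mul_of_nonneg_right ?_ (prod_nonneg fun _ _ => norm_nonneg _)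
  refine expect_mul_le_expect_mul_of_condMean_le (D := C.map ι) (fun _ => norm_nonneg _)
    (fun σ ρ => hΦ.mul_ofSubtype_left σ τ ρ) fun σ => ?_
  exact condMean_prod_le_prod_sqrt (fun i hi => by simpa using disjoint_left.1 hQ hi)
    (fun i j => ‖z j (τ i)‖) σ

/-- The bound on the rows is the one on permanents, applied conditionally on the rows chosen in
`C`; the columns are treated by Cauchy–Schwarz and Maclaurin's inequality. -/
theorem norm_mixedMean_le {Φ : Perm α → Perm γ → K} (hΦ : IsLocalAt ι C fun σ τ => ‖Φ σ τ‖)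
    (hQ : Disjoint Q C) {k : ℝ}
    (hk : ∀ J R, #J = #C → #R = #C → 𝔼 r ∈ Rᶜ, 𝔼 j ∈ Jᶜ, ‖z j r‖ ^ 2 ≤ k) :
    ‖mixedMean z ι C Q Φ‖ ≤
      √(𝔼 τ, (𝔼 σ, ‖Φ σ τ‖) ^ 2) * √k ^ #Q * √(𝔼 r, ‖𝔼 j, z j r‖ ^ 2) ^ #(Cᶜ \ Q) := by
  set m : γ → ℝ := fun r => ‖𝔼 j, z j r‖
  set V : Perm α → γ → ℝ := fun σ r => 𝔼 j ∈ ((C.map ι).map σ.toEmbedding)ᶜ, ‖z j r‖ ^ 2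
  set B : Perm γ → ℝ := condMean C fun τ => ∏ i ∈ Cᶜ \ Q, m (τ i) ^ 2
  have hV0 (σ) (r) : 0 ≤ V σ r := expect_nonneg fun _ _ => sq_nonneg _
  have hB0 (τ) : 0 ≤ B τ := expect_nonneg fun _ _ => prod_nonneg fun _ _ => sq_nonneg _
  have hB_mean : 𝔼 τ, B τ ≤ (𝔼 r, m r ^ 2) ^ #(Cᶜ \ Q) :=
    (expect_condMean C _).trans_le (expect_perm_prod_le_pow (fun _ => sq_nonneg _) _)
  calc ‖mixedMean z ι C Q Φ‖
      ≤ 𝔼 τ, 𝔼 σ, ‖Φ σ τ‖ * ((∏ i ∈ Q, √(V σ (τ i))) * ∏ i ∈ Cᶜ \ Q, m (τ i)) :=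
        (RCLike.norm_expect_le (K := K)).trans <|
          expect_le_expect fun τ _ => norm_expect_mul_prod_mix_le hΦ hQ τ
    _ ≤ 𝔼 σ, 𝔼 τ, ‖Φ σ τ‖ * (√k ^ #Q * √(B τ)) := by
        rw [expect_comm]
        refine expect_le_expect fun σ _ => ?_
        refine expect_mul_le_expect_mul_of_condMean_le (D := C) (fun _ => norm_nonneg _)
          (fun τ ρ => hΦ.mul_ofSubtype_right σ τ ρ) fun τ => ?_
        exact condMean_prod_sqrt_mul_prod_le (hV0 σ) m hQ _ (hk _ _ (by simp) (by simp))
    _ = √k ^ #Q * 𝔼 τ, (𝔼 σ, ‖Φ σ τ‖) * √(B τ) := by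
        simp only [mul_left_comm _ (√k ^ #Q), ← mul_expect]
        rw [expect_comm]
        simp only [← expect_mul]
    _ ≤ √k ^ #Q * (√(𝔼 τ, (𝔼 σ, ‖Φ σ τ‖) ^ 2) * √(𝔼 r, m r ^ 2) ^ #(Cᶜ \ Q)) := by
        refine mul_le_mul_of_nonneg_left ?_ (by positivity)
        refine (expect_mul_le_sqrt_mul_sqrt _ _).trans ?_
        simp only [Real.sq_sqrt (hB0 _)]
        refine mul_le_mul_of_nonneg_left ?_ (Real.sqrt_nonneg _)
        rw [Real.sqrt_le_left (by positivity), ← pow_mul, mul_comm, pow_mul,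
          Real.sq_sqrt (expect_nonneg fun _ _ => sq_nonneg _)]
        exact hB_mean
    _ = _ := by ring

end NormBound

section Constants

theorem inv_card_embedding {ν m : ℕ} (h : ν ≤ m) :
    (Fintype.card (Fin ν ↪ Fin m) : ℝ)⁻¹ = (m - ν).factorial / m.factorial := by
  rw [Fintype.card_embedding_eq, Fintype.card_fin, Fintype.card_fin,
    ← Nat.factorial_mul_descFactorial h, Nat.cast_mul, div_mul_cancel_left₀]
  exact_mod_cast (Nat.factorial_ne_zero _)

variable {N n ν : ℕ}

theorem sqrt_expect_sq_expect_embedding (hνN : ν ≤ N) (hνn : ν ≤ n)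
    (Y : (Fin ν ↪ Fin N) → (Fin ν ↪ Fin n) → ℝ) :
    √(𝔼 c, (𝔼 u, Y u c) ^ 2) =
      ((N - ν).factorial / N.factorial : ℝ) * √((n - ν).factorial / n.factorial : ℝ) *
        √(∑ c, (∑ u, Y u c) ^ 2) := by
  simp only [Fintype.expect_eq_sum_div_card, div_eq_inv_mul _ ((Fintype.card _ : ℕ) : ℝ),
    inv_card_embedding hνN, inv_card_embedding hνn, mul_pow, ← mul_sum]
  rw [mul_left_comm, Real.sqrt_mul (by positivity), Real.sqrt_mul (by positivity),
    Real.sqrt_sq (by positivity), mul_assoc]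

theorem expect_compl_le_kappa (hnN : n ≤ N) (Z : Matrix (Fin N) (Fin n) ℂ) {J : Finset (Fin N)}
    {R : Finset (Fin n)} (hJ : #J = ν) (hR : #R = ν) :
    𝔼 r ∈ Rᶜ, 𝔼 j ∈ Jᶜ, ‖Z j r‖ ^ 2 ≤ kappa Z ν := by
  have hνn : ν ≤ n := by simpa [hR] using card_le_univ R
  obtain hν | hν := hνn.eq_or_lt
  · rw [(card_eq_iff_eq_univ R).1 (by simp [hR, hν]), compl_univ, expect_empty, kappa,
      if_neg (by simp [hν])]
    exact zero_le_one
  · have hJc : (#Jᶜ : ℝ) = N - ν := by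
      rw [card_compl, hJ, Fintype.card_fin, Nat.cast_sub (hνn.trans hnN)]
    have hRc : (#Rᶜ : ℝ) = n - ν := by rw [card_compl, hR, Fintype.card_fin, Nat.cast_sub hνn]
    simp only [expect_eq_sum_div_card, ← sum_div, div_div, hJc, hRc]
    rw [kappa, if_pos (Nat.succ_le_of_lt hν), sum_comm, div_eq_inv_mul, one_div,
      mul_comm ((N : ℝ) - ν)]
    refine mul_le_mul_of_nonneg_left ?_
      (inv_nonneg.2 (mul_nonneg (hRc ▸ Nat.cast_nonneg _) (hJc ▸ Nat.cast_nonneg _)))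
    exact le_ciSup
      (f := fun q : {q : Finset (Fin N) × Finset (Fin n) // #q.1 = ν ∧ #q.2 = ν} =>
        ∑ j ∈ q.1.1ᶜ, ∑ r ∈ q.1.2ᶜ, ‖Z j r‖ ^ 2)
      (Set.finite_range _).bddAbove ⟨(J, R), hJ, hR⟩

theorem colMean_eq_expect (Z : Matrix (Fin N) (Fin n) ℂ) (r : Fin n) :
    colMean Z r = 𝔼 j, Z j r := by
  rw [colMean, Fintype.expect_eq_sum_div_card, Fintype.card_fin, one_div_mul_eq_div]

theorem beta_eq_expect (Z : Matrix (Fin N) (Fin n) ℂ) :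
    beta Z = 𝔼 r, ‖𝔼 j, Z j r‖ ^ 2 := by
  simp only [beta, colMean_eq_expect, Fintype.expect_eq_sum_div_card (K := ℝ), Fintype.card_fin,
    one_div_mul_eq_div]

theorem norm_mixedMean_map_le (hnN : n ≤ N) (Z : Matrix (Fin N) (Fin n) ℂ) (ι : Fin n ↪ Fin N)
    (e : Fin ν ↪ Fin n) {Q : Finset (Fin n)} (hQ : Disjoint Q (univ.map e))
    {Φ : Perm (Fin N) → Perm (Fin n) → ℂ} {Y : (Fin ν ↪ Fin N) → (Fin ν ↪ Fin n) → ℝ}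
    (hΦ : ∀ σ τ, ‖Φ σ τ‖ = Y ((e.trans ι).trans σ.toEmbedding) (e.trans τ.toEmbedding)) :
    ‖mixedMean Z ι (univ.map e) Q Φ‖ ≤
      ((N - ν).factorial / N.factorial : ℝ) * √((n - ν).factorial / n.factorial : ℝ) *
        √(∑ c, (∑ u, Y u c) ^ 2) * √(kappa Z ν) ^ #Q * √(beta Z) ^ (n - ν - #Q) := by
  have hνn : ν ≤ n := by simpa using Fintype.card_le_of_embedding e
  have hcard : #(univ.map e) = ν := by simp
  have hlocal : IsLocalAt ι (univ.map e) fun σ τ => ‖Φ σ τ‖ := fun σ σ' τ τ' hσ hτ => by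
    dsimp only
    rw [hΦ, hΦ]
    congr 1 <;> ext i <;> simp [hσ, hτ]
  have hmean : 𝔼 τ, (𝔼 σ, ‖Φ σ τ‖) ^ 2 = 𝔼 c, (𝔼 u, Y u c) ^ 2 := by
    simp only [hΦ]
    rw [← expect_perm_embedding _ e]
    exact expect_congr rfl fun τ _ =>
      congrArg (· ^ 2) (expect_perm_embedding (fun u => Y u (e.trans τ.toEmbedding)) _)
  have hle := norm_mixedMean_le hlocal hQ fun J R hJ hR =>
    expect_compl_le_kappa hnN Z (hJ.trans hcard) (hR.trans hcard)
  rwa [hmean, sqrt_expect_sq_expect_embedding (hνn.trans hnN) hνn, ← beta_eq_expect,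
    card_sdiff_of_subset (subset_compl_iff_disjoint_right.2 hQ), card_compl, Fintype.card_fin,
    hcard] at hle

theorem norm_mixedMean_le_theta3 (hnN : n ≤ N) (Z : Matrix (Fin N) (Fin n) ℂ) (ι : Fin n ↪ Fin N)
    {a b c : Fin n} (habc : [a, b, c].Nodup) {Q : Finset (Fin n)} (hQ : Disjoint Q {c, b, a})
    {Φ : Perm (Fin N) → Perm (Fin n) → ℂ}
    (hΦ : ∀ σ τ, ‖Φ σ τ‖ =
      ‖(entryDiff Z ι a b a * entryDiff Z ι a b b * entryDiff Z ι a c c) σ τ‖) :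
    ‖mixedMean Z ι {c, b, a} Q Φ‖ ≤
      theta3 Z * √(kappa Z 3) ^ #Q * √(beta Z) ^ (n - 3 - #Q) := by
  let e : Fin 3 ↪ Fin n := ⟨![a, b, c], List.nodup_ofFn.1 habc⟩
  have he : univ.map e = {c, b, a} := by
    ext i
    simp [e, Fin.exists_fin_succ, eq_comm, or_comm, or_left_comm]
  rw [theta3, if_pos (by simpa using Fintype.card_le_of_embedding e)]
  rw [← he] at hQ ⊢
  exact norm_mixedMean_map_le hnN Z ι e hQ hΦ
    (Y := fun u c => ‖rowDiff Z (u 0) (u 1) (c 0) * rowDiff Z (u 0) (u 1) (c 1) *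
      rowDiff Z (u 0) (u 2) (c 2)‖)

theorem norm_mixedMean_le_theta4 (hnN : n ≤ N) (Z : Matrix (Fin N) (Fin n) ℂ) (ι : Fin n ↪ Fin N)
    {a b c d : Fin n} (habcd : [a, b, c, d].Nodup) {Q : Finset (Fin n)}
    (hQ : Disjoint Q {d, c, b, a}) {Φ : Perm (Fin N) → Perm (Fin n) → ℂ}
    (hΦ : ∀ σ τ, ‖Φ σ τ‖ =
      ‖(entryDiff Z ι a b a * entryDiff Z ι a b b * entryDiff Z ι c d c * entryDiff Z ι c d d)
        σ τ‖) :
    ‖mixedMean Z ι {d, c, b, a} Q Φ‖ ≤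
      theta4 Z * √(kappa Z 4) ^ #Q * √(beta Z) ^ (n - 4 - #Q) := by
  let e : Fin 4 ↪ Fin n := ⟨![a, b, c, d], List.nodup_ofFn.1 habcd⟩
  have he : univ.map e = {d, c, b, a} := by
    ext i
    simp [e, Fin.exists_fin_succ, eq_comm, or_comm, or_left_comm]
  rw [theta4, if_pos (by simpa using Fintype.card_le_of_embedding e)]
  rw [← he] at hQ ⊢
  exact norm_mixedMean_map_le hnN Z ι e hQ hΦ
    (Y := fun u c => ‖rowDiff Z (u 0) (u 1) (c 0) * rowDiff Z (u 0) (u 1) (c 1) *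
      rowDiff Z (u 2) (u 3) (c 2) * rowDiff Z (u 2) (u 3) (c 3)‖)

end Constants

section Telescope

theorem norm_sub_empty_le_sum_range {γ E : Type*} [DecidableEq γ] [SeminormedAddCommGroup E]
    {F : Finset γ → E} {b : ℕ → ℝ} {Q : Finset γ}
    (hF : ∀ s R, s ∉ R → insert s R ⊆ Q → ‖F (insert s R) - F R‖ ≤ b #R) :
    ‖F Q - F ∅‖ ≤ ∑ j ∈ range #Q, b j := by
  induction Q using Finset.induction_on with
  | empty => simp
  | insert s Q hs ih =>
    rw [card_insert_of_notMem hs, sum_range_succ, add_comm, ← sub_add_sub_cancel _ (F Q)]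
    exact norm_add_le_of_le (hF s Q hs Subset.rfl)
      (ih fun t R ht hR => hF t R ht (hR.trans (subset_insert s Q)))

variable {N n : ℕ}

/-- The mean of the product of the two differences between the random rows chosen at `s` and at
`t`, in the two columns chosen at `s` and at `t`, with random entries at the indices in `Q` and
column means elsewhere. -/
noncomputable def pairMean (Z : Matrix (Fin N) (Fin n) ℂ) (ι : Fin n ↪ Fin N) (s t : Fin n)
    (Q : Finset (Fin n)) : ℂ :=
  mixedMean Z ι {t, s} Q (entryDiff Z ι s t s * entryDiff Z ι s t t)

/-- The bound for the change of `pairMean Z ι s t Q` when an index is added to a set `Q` of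
cardinality `j`. -/
noncomputable def stepBound (Z : Matrix (Fin N) (Fin n) ℂ) (j : ℕ) : ℝ :=
  (N : ℝ)⁻¹ * (2 * (theta3 Z * √(kappa Z 3) ^ j * √(beta Z) ^ (n - 3 - j)) +
    1 / 2 * (j * (theta4 Z * √(kappa Z 4) ^ (j - 1) * √(beta Z) ^ (n - 3 - j))))

variable {Z : Matrix (Fin N) (Fin n) ℂ} {ι : Fin n ↪ Fin N} {Q : Finset (Fin n)} {s t r q : Fin n}

theorem mixedMean_empty_insert_sub (hs : s ∉ Q) :
    mixedMean Z ι ∅ (insert s Q) 1 - mixedMean Z ι ∅ Q 1 =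
      -(2 * (N : ℂ))⁻¹ * ∑ t ∈ Q, pairMean Z ι s t (Q.erase t) := by
  have h := mixedMean_insert_sub (z := Z) (ι := ι) (C := ∅) (Φ := 1) (fun _ _ _ _ _ _ => rfl)
    (disjoint_empty_right Q) (notMem_empty s) hs
  simp only [sum_empty, mul_one, insert_empty_eq, Fintype.card_fin, zero_sub] at h
  refine h.trans ?_
  simp only [pairMean, mul_inv]
  ring

theorem norm_entryDiff_comm (s t r : Fin n) (σ : Perm (Fin N)) (τ : Perm (Fin n)) :
    ‖entryDiff Z ι s t r σ τ‖ = ‖entryDiff Z ι t s r σ τ‖ :=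
  norm_sub_rev _ _

theorem norm_mixedMean_entryDiff_mul_le (hnN : n ≤ N) (hst : s ≠ t) (hr : r ∉ ({t, s} : Finset _))
    (hQ : Disjoint Q {r, t, s}) (hq : q ∈ ({t, s} : Finset _)) :
    ‖mixedMean Z ι {r, t, s} Q
        (entryDiff Z ι r q r * (entryDiff Z ι s t s * entryDiff Z ι s t t))‖ ≤
      theta3 Z * √(kappa Z 3) ^ #Q * √(beta Z) ^ (n - 3 - #Q) := by
  simp only [mem_insert, mem_singleton, not_or] at hr hq
  rcases hq with rfl | rfl
  · rw [pair_comm] at hQ ⊢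
    refine norm_mixedMean_le_theta3 hnN Z ι (by simp [hst.symm, Ne.symm hr.1, Ne.symm hr.2]) hQ
      fun σ τ => ?_
    simp only [Pi.mul_apply, norm_mul, norm_entryDiff_comm r, norm_entryDiff_comm s]
    ring
  · refine norm_mixedMean_le_theta3 hnN Z ι (by simp [hst, Ne.symm hr.1, Ne.symm hr.2]) hQ
      fun σ τ => ?_
    simp only [Pi.mul_apply, norm_mul, norm_entryDiff_comm r]
    ring

theorem norm_mixedMean_entryDiff_mul_entryDiff_mul_le (hnN : n ≤ N) (hst : s ≠ t)
    (hr : r ∉ ({t, s} : Finset _)) (hQ : Disjoint Q {q, r, t, s})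
    (hq : q ∉ ({r, t, s} : Finset _)) :
    ‖mixedMean Z ι {q, r, t, s} Q
        (entryDiff Z ι r q r * entryDiff Z ι r q q * (entryDiff Z ι s t s * entryDiff Z ι s t t))‖ ≤
      theta4 Z * √(kappa Z 4) ^ #Q * √(beta Z) ^ (n - 4 - #Q) := by
  refine norm_mixedMean_le_theta4 hnN Z ι (by grind) hQ fun σ τ => ?_
  simp only [Pi.mul_apply, norm_mul]
  ring

theorem norm_pairMean_insert_sub_le (hnN : n ≤ N) (hst : s ≠ t) (hr : r ∉ ({t, s} : Finset _))
    (hrQ : r ∉ Q) (hQ : Disjoint Q {t, s}) :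
    ‖pairMean Z ι s t (insert r Q) - pairMean Z ι s t Q‖ ≤ stepBound Z #Q := by
  have hQr : Disjoint Q {r, t, s} := disjoint_insert_right.2 ⟨hrQ, hQ⟩
  have hfour : ∀ q ∈ Q, ‖mixedMean Z ι {q, r, t, s} (Q.erase q)
      (entryDiff Z ι r q r * entryDiff Z ι r q q * (entryDiff Z ι s t s * entryDiff Z ι s t t))‖ ≤
      theta4 Z * √(kappa Z 4) ^ (#Q - 1) * √(beta Z) ^ (n - 3 - #Q) := fun q hq => by
    have hcard := card_pos.2 ⟨q, hq⟩
    rw [show n - 3 - #Q = n - 4 - (#Q - 1) by omega, ← card_erase_of_mem hq]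
    exact norm_mixedMean_entryDiff_mul_entryDiff_mul_le hnN hst hr
      (disjoint_insert_right.2 ⟨notMem_erase q Q, hQr.mono_left (erase_subset q Q)⟩)
      (disjoint_left.1 hQr hq)
  have hlocal : IsLocalAt ι {t, s} (entryDiff Z ι s t s * entryDiff Z ι s t t) :=
    (isLocalAt_entryDiff (by simp) (by simp) (by simp)).mul
      (isLocalAt_entryDiff (by simp) (by simp) (by simp))
  refine (congrArg _ (mixedMean_insert_sub hlocal hQ hr hrQ)).trans_le ?_
  rw [norm_mul, stepBound, norm_inv, Fintype.card_fin, Complex.norm_natCast]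
  refine mul_le_mul_of_nonneg_left (norm_sub_le_of_le ?_ ?_) (by positivity)
  · refine (norm_sum_le_of_le _ fun q hq =>
      norm_mixedMean_entryDiff_mul_le hnN hst hr hQr hq).trans_eq ?_
    rw [sum_const, card_pair hst.symm, nsmul_eq_mul, Nat.cast_two]
  · rw [norm_mul, norm_div, norm_one, Complex.norm_two]
    refine mul_le_mul_of_nonneg_left ((norm_sum_le_of_le _ hfour).trans_eq ?_) (by norm_num)
    rw [sum_const, nsmul_eq_mul]

theorem norm_pairMean_sub_empty_le (hnN : n ≤ N) (hst : s ≠ t) (hQ : Disjoint Q {t, s}) :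
    ‖pairMean Z ι s t Q - pairMean Z ι s t ∅‖ ≤ ∑ j ∈ range #Q, stepBound Z j :=
  norm_sub_empty_le_sum_range fun _ _ hrR hR =>
    norm_pairMean_insert_sub_le hnN hst (disjoint_left.1 hQ (hR (mem_insert_self _ _))) hrR
      (hQ.mono_left ((subset_insert _ _).trans hR))

theorem norm_mixedMean_sub_empty_add_le (hnN : n ≤ N) {G : ℂ}
    (hG : ∀ s t, s ≠ t → pairMean Z ι s t ∅ = G) (Q : Finset (Fin n)) :
    ‖mixedMean Z ι ∅ Q 1 - mixedMean Z ι ∅ ∅ 1 +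
        (2 * (N : ℂ))⁻¹ * ((∑ k ∈ range #Q, (k : ℂ)) * G)‖ ≤
      ∑ k ∈ range #Q, (2 * (N : ℝ))⁻¹ * (k * ∑ j ∈ range (k - 1), stepBound Z j) := by
  set F : Finset (Fin n) → ℂ := fun Q =>
    mixedMean Z ι ∅ Q 1 + (2 * (N : ℂ))⁻¹ * ((∑ k ∈ range #Q, (k : ℂ)) * G)
  have hstep (s R) (hs : s ∉ R) : F (insert s R) - F R =
      -(2 * (N : ℂ))⁻¹ * ∑ t ∈ R, (pairMean Z ι s t (R.erase t) - G) := by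
    simp only [F]
    rw [card_insert_of_notMem hs, sum_range_succ, sum_sub_distrib, sum_const, nsmul_eq_mul]
    linear_combination mixedMean_empty_insert_sub hs
  have hmain := norm_sub_empty_le_sum_range (F := F) (Q := Q)
    (b := fun k => (2 * (N : ℝ))⁻¹ * (k * ∑ j ∈ range (k - 1), stepBound Z j))
    fun s R hs _ => by
      rw [hstep s R hs, norm_mul, norm_neg, norm_inv, norm_mul, Complex.norm_natCast,
        Complex.norm_two]
      refine mul_le_mul_of_nonneg_left ((norm_sum_le_of_le _ fun t ht => ?_).trans_eq
        ((sum_const _).trans (nsmul_eq_mul _ _))) (by positivity)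
      have hst : s ≠ t := (ne_of_mem_of_not_mem ht hs).symm
      rw [← hG s t hst, ← card_erase_of_mem ht]
      exact norm_pairMean_sub_empty_le hnN hst (by simp [hs])
  have hF : F Q - F ∅ = mixedMean Z ι ∅ Q 1 - mixedMean Z ι ∅ ∅ 1 +
      (2 * (N : ℂ))⁻¹ * ((∑ k ∈ range #Q, (k : ℂ)) * G) := by
    simp only [F, card_empty, range_zero, sum_empty, zero_mul, mul_zero, add_zero]
    ring
  rwa [hF] at hmain

end Telescope

section Evaluation

variable {α γ K : Type*} [RCLike K] [Fintype α] [DecidableEq α] [Fintype γ] [DecidableEq γ]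

theorem mixedMean_empty_empty (z : α → γ → K) (ι : γ ↪ α) :
    mixedMean z ι ∅ ∅ 1 = ∏ r, 𝔼 j, z j r := by
  have hprod (τ : Perm γ) (σ : Perm α) : ∏ i, mix z ι ∅ σ τ i = ∏ r, 𝔼 j, z j r := by
    simp only [mix_of_notMem (notMem_empty _), Equiv.prod_comp τ fun r => 𝔼 j, z j r]
  simp only [mixedMean, Pi.one_apply, one_mul, compl_empty, hprod, Fintype.expect_const]

theorem mixedMean_empty_univ (z : α → γ → K) (ι : γ ↪ α) :
    mixedMean z ι ∅ univ 1 = 𝔼 u : γ ↪ α, ∏ r, z (u r) r := by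
  have hmean (τ : Perm γ) :
      𝔼 σ : Perm α, ∏ i, z (σ (ι i)) (τ i) = 𝔼 u : γ ↪ α, ∏ r, z (u r) r := by
    refine (expect_perm_embedding (fun u => ∏ i, z (u i) (τ i)) ι).trans ?_
    refine Fintype.expect_equiv (Equiv.embeddingCongr τ (Equiv.refl α)) _ _ fun u => ?_
    rw [← Equiv.prod_comp τ fun r => z _ r]
    simp [Equiv.embeddingCongr]
  simp only [mixedMean, Pi.one_apply, one_mul, compl_empty, mix_of_mem (mem_univ _), hmean,
    Fintype.expect_const]

theorem mixedMean_pair_empty (z : α → γ → K) (ι : γ ↪ α) {s t : γ} (hst : s ≠ t) :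
    mixedMean z ι {t, s} ∅ (entryDiff z ι s t s * entryDiff z ι s t t) =
      2 / ((Fintype.card α : K) - 1) * 𝔼 R ∈ univ.powersetCard 2,
        (∏ r ∈ Rᶜ, 𝔼 j, z j r) * ∑ j, ∏ r ∈ R, (z j r - 𝔼 i, z i r) := by
  set f : Finset γ → K := fun R =>
    (∏ r ∈ Rᶜ, 𝔼 j, z j r) * ∑ j, ∏ r ∈ R, (z j r - 𝔼 i, z i r) with hf
  have hpair (τ : Perm γ) :
      𝔼 σ, (entryDiff z ι s t s * entryDiff z ι s t t) σ τ * ∏ i ∈ {t, s}ᶜ, mix z ι ∅ σ τ i =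
        2 / ((Fintype.card α : K) - 1) * f (({t, s} : Finset γ).map τ.toEmbedding) := by
    have hcompl : (({t, s} : Finset γ).map τ.toEmbedding)ᶜ =
        ({t, s} : Finset γ)ᶜ.map τ.toEmbedding := by
      ext i
      simp only [mem_compl, mem_map_equiv]
    simp only [mix_of_notMem (notMem_empty _), ← expect_mul, Pi.mul_apply, entryDiff,
      expect_perm_sub_mul_sub (fun j => z j (τ s)) (fun j => z j (τ t)) (ι.injective.ne hst), hf,
      hcompl, prod_map, prod_pair hst.symm, Equiv.coe_toEmbedding, mul_comm (z _ (τ t) - _)]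
    ring
  rw [← card_pair hst.symm, ← expect_perm_map, mul_expect]
  exact expect_congr rfl fun τ _ => hpair τ

variable {N n : ℕ}

theorem expect_embedding_prod_eq_rectPermanent (hnN : n ≤ N) (Z : Matrix (Fin N) (Fin n) ℂ) :
    𝔼 u : Fin n ↪ Fin N, ∏ r, Z (u r) r =
      ((N - n).factorial / N.factorial : ℂ) * rectPermanent Z := by
  have hcard := congrArg Complex.ofReal (inv_card_embedding hnN)
  push_cast at hcard
  rw [Fintype.expect_eq_sum_div_card, div_eq_inv_mul, hcard, rectPermanent]

theorem pairMean_empty (Z : Matrix (Fin N) (Fin n) ℂ) (ι : Fin n ↪ Fin N) {s t : Fin n}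
    (hst : s ≠ t) :
    pairMean Z ι s t ∅ = 4 / ((n : ℂ) * ((n : ℂ) - 1) * ((N : ℂ) - 1)) * secondOrderTerm Z := by
  refine (mixedMean_pair_empty Z ι hst).trans ?_
  simp only [← colMean_eq_expect]
  rw [expect_eq_sum_div_card, card_powersetCard, card_univ, Fintype.card_fin, Fintype.card_fin,
    Nat.cast_choose_two, ← secondOrderTerm]
  field_simp
  norm_num [mul_comm]

end Evaluation

section Summation

theorem sum_range_mul_sum_range (E : ℕ → ℝ) (n : ℕ) :
    ∑ k ∈ range n, (k : ℝ) * ∑ j ∈ range (k - 1), E j =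
      ∑ j ∈ range (n - 2), ((n : ℝ) * (n - 1) - (j + 2) * (j + 1)) / 2 * E j := by
  induction n with
  | zero => simp
  | succ n ih =>
    rw [sum_range_succ, ih]
    rcases n with _ | _ | n
    · simp
    · simp
    · rw [show n + 1 + 1 - 1 = n + 1 by omega, show n + 1 + 1 + 1 - 2 = n + 1 by omega,
        show n + 1 + 1 - 2 = n by omega, mul_sum, sum_range_succ, sum_range_succ _ n, ← add_assoc,
        ← sum_add_distrib]
      push_cast
      congr 1
      · exact sum_congr rfl fun j _ => by ring
      · ring

theorem fPoly_eq_sum_range {n : ℕ} (hn : 2 ≤ n) (x y : ℝ) :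
    fPoly n x y =
      ∑ j ∈ range (n - 2), ((n : ℝ) * (n - 1) - (j + 2) * (j + 1)) * (x ^ (n - 3 - j) * y ^ j) := by
  rw [fPoly, ← Finset.Ico_add_one_right_eq_Icc, sum_Ico_eq_sum_range,
    show n + 1 - 3 = n - 2 by omega]
  refine sum_congr rfl fun j _ => ?_
  rw [show n - (3 + j) = n - 3 - j by omega, Nat.add_sub_cancel_left]
  push_cast
  ring

theorem gPoly_eq_sum_range {n : ℕ} (hn : 2 ≤ n) (x y : ℝ) :
    gPoly n x y = ∑ j ∈ range (n - 2),
      ((n : ℝ) * (n - 1) - (j + 2) * (j + 1)) * (j * (x ^ (n - 3 - j) * y ^ (j - 1))) := by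
  have hthree : gPoly n x y = ∑ k ∈ Icc 3 n,
      ((k : ℝ) - 3) * ((n : ℝ) + k - 2) * ((n : ℝ) - k + 1) * x ^ (n - k) * y ^ (k - 4) :=
    sum_subset (Icc_subset_Icc_left (by norm_num)) fun k hk hk' => by
      have : k = 3 := by
        simp only [mem_Icc] at hk hk'
        omega
      simp [this]
  rw [hthree, ← Finset.Ico_add_one_right_eq_Icc, sum_Ico_eq_sum_range,
    show n + 1 - 3 = n - 2 by omega]
  refine sum_congr rfl fun j _ => ?_
  rw [show n - (3 + j) = n - 3 - j by omega, show 3 + j - 4 = j - 1 by omega]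
  push_cast
  ring

theorem sum_stepBound {N n : ℕ} (hn : 2 ≤ n) (Z : Matrix (Fin N) (Fin n) ℂ) :
    ∑ k ∈ range n, (2 * (N : ℝ))⁻¹ * (k * ∑ j ∈ range (k - 1), stepBound Z j) =
      theta3 Z / (2 * (N : ℝ) ^ 2) * fPoly n (√(beta Z)) (√(kappa Z 3)) +
        theta4 Z / (8 * (N : ℝ) ^ 2) * gPoly n (√(beta Z)) (√(kappa Z 4)) := by
  rw [← mul_sum, sum_range_mul_sum_range, fPoly_eq_sum_range hn, gPoly_eq_sum_range hn, mul_sum,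
    mul_sum, mul_sum, ← sum_add_distrib]
  refine sum_congr rfl fun j _ => ?_
  rw [stepBound]
  ring

theorem two_mul_natCast_inv_mul_sum_range {N n : ℕ} (hn : 2 ≤ n) (S : ℂ) :
    (2 * (N : ℂ))⁻¹ *
        ((∑ k ∈ range n, (k : ℂ)) * (4 / ((n : ℂ) * ((n : ℂ) - 1) * ((N : ℂ) - 1)) * S)) =
      S / ((N : ℂ) * ((N : ℂ) - 1)) := by
  have hn0 : (n : ℂ) ≠ 0 := Nat.cast_ne_zero.2 (by omega)
  have hn1 : (n : ℂ) - 1 ≠ 0 := sub_ne_zero.2 (Nat.cast_ne_one.2 (by omega))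
  rw [← Nat.cast_sum, sum_range_id, ← Nat.choose_two_right, Nat.cast_choose_two]
  field_simp
  norm_num

end Summation

end PermApprox

theorem mainTheorem5 (N n : ℕ) (hn : 2 ≤ n) (hnN : n ≤ N) (Z : Matrix (Fin N) (Fin n) ℂ) :
    ‖((N - n).factorial / N.factorial : ℂ) * PermApprox.rectPermanent Z
        - ∏ r, PermApprox.colMean Z r
        + PermApprox.secondOrderTerm Z / ((N : ℂ) * ((N : ℂ) - 1))‖
      ≤ PermApprox.theta3 Z / (2 * (N : ℝ) ^ 2)
            * PermApprox.fPoly n (√(PermApprox.beta Z)) (√(PermApprox.kappa Z 3))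
        + PermApprox.theta4 Z / (8 * (N : ℝ) ^ 2)
            * PermApprox.gPoly n (√(PermApprox.beta Z)) (√(PermApprox.kappa Z 4)) := by
  have hmain := PermApprox.norm_mixedMean_sub_empty_add_le hnN
    (fun s t => PermApprox.pairMean_empty Z (Fin.castLEEmb hnN) (s := s) (t := t)) Finset.univ
  have hper := (PermApprox.mixedMean_empty_univ Z (Fin.castLEEmb hnN)).trans
    (PermApprox.expect_embedding_prod_eq_rectPermanent hnN Z)
  have hmeans := PermApprox.mixedMean_empty_empty Z (Fin.castLEEmb hnN)
  simp only [← PermApprox.colMean_eq_expect] at hmeans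
  rwa [hper, hmeans, Finset.card_univ, Fintype.card_fin,
    PermApprox.two_mul_natCast_inv_mul_sum_range hn, PermApprox.sum_stepBound hn] at hmain
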